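/- Let $k$ be a field and let $A$ be a profinite $k$-algebra, i.e. a (unital, associative, not necessarily commutative) $k$-algebra isomorphic to the inverse limit of a directed inverse system of finite-dimensional $k$-algebras. Suppose that $A$ is a left D-ring, meaning that every left ideal of $A$ is the left annihilator $\{a\in A : ax=0 \text{ for all } x\in S\}$ of some subset $S\subseteq A$, or that $A$ is a right D-ring, meaning that every right ideal of $A$ is the right annihilator $\{a\in A : xa=0 \text{ for all } x\in S\}$ of some subset $S\subseteq A$. Then $A$ is a quasi-Frobenius (QF) ring, i.e. $A$ is left and right artinian and is injective both as a left and as a right module over itself. Moreover, $A$ is finite-dimensional over $k$. -/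

import Mathlib

universe w v u

/-- The inverse limit of an inverse system of `k`-algebras `B i` with transition maps
`f : B j → B i` for `i ≤ j`: the subalgebra of compatible families in `∏ i, B i`. -/
def inverseLimitSubalgebra (k : Type*) [Field k] {ι : Type*} [Preorder ι] (B : ι → Type*)
    [∀ i, Ring (B i)] [∀ i, Algebra k (B i)] (f : ∀ ⦃i j : ι⦄, i ≤ j → (B j →ₐ[k] B i)) :
    Subalgebra k (∀ i, B i) where
  carrier := {x | ∀ (i j : ι) (h : i ≤ j), f h (x j) = x i}
  mul_mem' hx hy i j h := by simp [hx i j h, hy i j h]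
  add_mem' hx hy i j h := by simp [hx i j h, hy i j h]
  algebraMap_mem' r i j h := by simp

/-- A `k`-algebra is profinite if it is isomorphic, as a `k`-algebra, to the inverse limit of an
inverse system of finite-dimensional (associative, unital) `k`-algebras and algebra homomorphisms
indexed by a nonempty directed preordered set. -/
def IsProfiniteAlgebra (k : Type*) [Field k] (A : Type*) [Ring A] [Algebra k A] : Prop :=
  ∃ (ι : Type w) (_ : Preorder ι) (_ : IsDirectedOrder ι) (_ : Nonempty ι)
    (B : ι → Type v) (_ : ∀ i, Ring (B i)) (_ : ∀ i, Algebra k (B i))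
    (f : ∀ ⦃i j : ι⦄, i ≤ j → (B j →ₐ[k] B i)),
    (∀ i, FiniteDimensional k (B i)) ∧
    (∀ i, f (le_refl i) = AlgHom.id k (B i)) ∧
    (∀ (i j l : ι) (hij : i ≤ j) (hjl : j ≤ l), (f hij).comp (f hjl) = f (hij.trans hjl)) ∧
    Nonempty (A ≃ₐ[k] inverseLimitSubalgebra k B f)

/-- A left D-ring: every left ideal is the left annihilator of some subset of the ring.
(`Ideal R` is the type of left ideals of `R`.) -/
def IsLeftDRing (R : Type*) [Ring R] : Prop :=
  ∀ I : Ideal R, ∃ S : Set R, ∀ r : R, r ∈ I ↔ ∀ x ∈ S, r * x = 0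

/-- A right D-ring: every right ideal is the right annihilator of some subset of the ring.
(`Submodule Rᵐᵒᵖ R` is the type of right ideals of `R`.) -/
def IsRightDRing (R : Type*) [Ring R] : Prop :=
  ∀ I : Submodule Rᵐᵒᵖ R, ∃ S : Set R, ∀ r : R, r ∈ I ↔ ∀ x ∈ S, x * r = 0

/-- A quasi-Frobenius (QF) ring: left and right artinian, and injective both as a left and as a
right module over itself. (Right `R`-modules are `Rᵐᵒᵖ`-modules. It is classical that any one of
the four combinations of a chain condition on one side and self-injectivity on one side is
equivalent to this; the two-sided form is the one that implies all the others outright.) -/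
structure IsQFRing (R : Type u) [Ring R] : Prop where
  left_artinian : IsArtinian R R
  right_artinian : IsArtinian Rᵐᵒᵖ R
  left_selfInjective : Module.Injective R R
  right_selfInjective : Module.Injective Rᵐᵒᵖ R

/-! A profinite algebra is linearly compact: a functional on its dual agrees with evaluation at a
point on all continuous functionals, i.e. those factoring through a finite stage (`exists_eval_eq`).
In a left D-ring every left ideal is closed, including the union of a chain, and compactness then
rules out strictly increasing sequences. In the resulting noetherian ring the annihilators of the
kernels of the projections stabilize, hence so do the kernels, and some projection is injective.

In finite dimension the crux is that the left condition implies the right one. Lifts of primitive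
idempotents modulo the radical cut the two-sided socle into corners. A dimension count along a
permutation of the idempotents (`IsBasicFrame.exists_perm`) leads to annihilators of maximal
one-sided ideals being simple or zero (`IsLeftDRing.exists_eq_mul_of_mem_ann`). This controls the
length of annihilators (`length_pairingAnn_add_length_mono`), and comparing the two sides makes the
lengths of a right ideal and its left annihilator exactly complementary. With both conditions, a map
from a left ideal to `A` is built up as a right multiplication one composition factor at a time, and
Baer's criterion applies; the other side is the opposite ring. -/

/-! ### Annihilators and passage to the opposite ring. -/

section Annihilators

variable {A : Type*} [Ring A]

/-- The left annihilator of a subset of a ring, as a left ideal. -/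
def leftAnn (s : Set A) : Ideal A where
  carrier := {a | ∀ x ∈ s, a * x = 0}
  add_mem' ha hb x hx := by rw [add_mul, ha x hx, hb x hx, add_zero]
  zero_mem' x _ := zero_mul x
  smul_mem' c a ha x hx := by rw [smul_eq_mul, mul_assoc, ha x hx, mul_zero]

/-- The right annihilator of a subset of a ring, as a right ideal. -/
def rightAnn (s : Set A) : Submodule Aᵐᵒᵖ A where
  carrier := {a | ∀ x ∈ s, x * a = 0}
  add_mem' ha hb x hx := by rw [mul_add, ha x hx, hb x hx, add_zero]
  zero_mem' x _ := mul_zero x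
  smul_mem' c a ha x hx := by
    rw [MulOpposite.smul_eq_mul_unop, ← mul_assoc, ha x hx, zero_mul]

theorem leftAnn_anti {s t : Set A} (h : s ⊆ t) : leftAnn t ≤ leftAnn s :=
  fun _ ha x hx => ha x (h hx)

/-- The largest candidate for `S` is the right annihilator of `I`, so only one inclusion of the
double annihilator condition has content. -/
theorem isLeftDRing_iff :
    IsLeftDRing A ↔ ∀ I : Ideal A, leftAnn (rightAnn (I : Set A) : Set A) ≤ I := by
  refine ⟨fun h I a ha => ?_, fun h I => ⟨rightAnn (I : Set A), fun r => ?_⟩⟩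
  · obtain ⟨S, hS⟩ := h I
    exact (hS a).2 fun x hx => ha x fun b hb => (hS b).1 hb x hx
  · exact ⟨fun hr x hx => hx r hr, fun hr => h I hr⟩

theorem isRightDRing_iff :
    IsRightDRing A ↔ ∀ I : Submodule Aᵐᵒᵖ A, rightAnn (leftAnn (I : Set A) : Set A) ≤ I := by
  refine ⟨fun h I a ha => ?_, fun h I => ⟨leftAnn (I : Set A), fun r => ?_⟩⟩
  · obtain ⟨S, hS⟩ := h I
    exact (hS a).2 fun x hx => ha x fun b hb => (hS b).1 hb x hx
  · exact ⟨fun hr x hx => hx r hr, fun hr => h I hr⟩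

/-- In a left D-ring, an element killing the right annihilator of `x` is a left multiple of
`x`. -/
theorem IsLeftDRing.exists_eq_mul (h : IsLeftDRing A) {x y : A}
    (hxy : ∀ a, x * a = 0 → y * a = 0) : ∃ c, y = c * x := by
  have : y ∈ Ideal.span {x} := by
    refine isLeftDRing_iff.1 h _ fun a ha => hxy a (ha x ?_)
    exact Ideal.mem_span_singleton_self x
  obtain ⟨c, hc⟩ := Ideal.mem_span_singleton'.1 this
  exact ⟨c, hc.symm⟩

theorem isLeftDRing_mulOpposite : IsLeftDRing Aᵐᵒᵖ ↔ IsRightDRing A := by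
  constructor
  · intro h I
    obtain ⟨S, hS⟩ := h (I.map (MulOpposite.opLinearEquiv Aᵐᵒᵖ : A ≃ₗ[Aᵐᵒᵖ] Aᵐᵒᵖ).toLinearMap)
    refine ⟨MulOpposite.op ⁻¹' S, fun r => ?_⟩
    have := hS (MulOpposite.op r)
    simp only [Submodule.mem_map] at this
    constructor
    · intro hr x hx
      exact MulOpposite.op_injective (this.1 ⟨r, hr, rfl⟩ _ hx)
    · intro hr
      obtain ⟨y, hy, hyr⟩ := this.2 fun x hx => by
        have := hr x.unop (by simpa using hx)
        exact MulOpposite.unop_injective (by simpa using this)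
      rwa [← show y = r from MulOpposite.op_injective hyr]
  · intro h I
    obtain ⟨S, hS⟩ := h (Submodule.comap
      (MulOpposite.opLinearEquiv Aᵐᵒᵖ : A ≃ₗ[Aᵐᵒᵖ] Aᵐᵒᵖ).toLinearMap I)
    refine ⟨MulOpposite.op '' S, fun r => ?_⟩
    have := hS r.unop
    simp only [Submodule.mem_comap] at this
    change (r ∈ I ↔ _) at this
    rw [this]
    constructor
    · rintro hr _ ⟨x, hx, rfl⟩
      exact MulOpposite.unop_injective (hr x hx)
    · intro hr x hx
      exact MulOpposite.op_injective (hr _ ⟨x, hx, rfl⟩)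

theorem isRightDRing_mulOpposite : IsRightDRing Aᵐᵒᵖ ↔ IsLeftDRing A := by
  constructor
  · intro h I
    let I' : Submodule Aᵐᵒᵖᵐᵒᵖ Aᵐᵒᵖ :=
      { carrier := {x | x.unop ∈ I}
        add_mem' := fun ha hb => I.add_mem ha hb
        zero_mem' := I.zero_mem
        smul_mem' := fun c x hx => I.mul_mem_left c.unop.unop hx }
    obtain ⟨S, hS⟩ := h I'
    refine ⟨MulOpposite.op ⁻¹' S, fun r => (hS (MulOpposite.op r)).trans ?_⟩
    constructor
    · intro hr x hx
      exact MulOpposite.op_injective (hr _ hx)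
    · intro hr x hx
      exact MulOpposite.unop_injective (hr x.unop (by simpa using hx))
  · intro h I
    let I' : Ideal A :=
      { carrier := {x | MulOpposite.op x ∈ I}
        add_mem' := fun ha hb => I.add_mem ha hb
        zero_mem' := I.zero_mem
        smul_mem' := fun c x hx => I.smul_mem (MulOpposite.op (MulOpposite.op c)) hx }
    obtain ⟨S, hS⟩ := h I'
    refine ⟨MulOpposite.op '' S, fun r => (hS r.unop).trans ?_⟩
    constructor
    · rintro hr _ ⟨x, hx, rfl⟩
      exact MulOpposite.unop_injective (hr x hx)
    · intro hr x hx
      exact MulOpposite.op_injective (hr _ ⟨x, hx, rfl⟩)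

end Annihilators

/-! ### Linear compactness and finite-dimensionality. -/

section Profinite

variable {k A ι : Type*} [Field k] [Ring A] [Algebra k A] [Preorder ι]
  {B : ι → Type*} [∀ i, AddCommGroup (B i)] [∀ i, Module k (B i)]

/-- Functionals that are triangular with respect to a sequence of vectors can simultaneously be
mapped to `1`. -/
theorem exists_dual_eq_one_of_triangular {V : Type*} [AddCommGroup V] [Module k V]
    (u : ℕ → Module.Dual k V) (x : ℕ → V) (hne : ∀ n, u n (x n) ≠ 0)
    (hlt : ∀ m n, n < m → u m (x n) = 0) :
    ∃ ψ : Module.Dual k (Module.Dual k V), ∀ n, ψ (u n) = 1 := by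
  have hli : LinearIndependent k u := by
    rw [linearIndependent_iff']
    intro s g hg i
    induction i using Nat.strong_induction_on with
    | _ i ih =>
      intro hi
      have h := LinearMap.congr_fun hg (x i)
      rw [LinearMap.sum_apply, Finset.sum_eq_single i] at h
      · simpa [hne i] using h
      · intro j hj hji
        rcases lt_or_gt_of_ne hji with hlt' | hgt
        · simp [ih j hlt' hj]
        · simp [hlt j i hgt]
      · exact fun h' => absurd hi h'
  obtain ⟨ψ, hψ⟩ := LinearMap.exists_extend ((Module.Basis.span hli).constr k fun _ => (1 : k))
  refine ⟨ψ, fun n => ?_⟩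
  have := LinearMap.congr_fun hψ (Module.Basis.span hli n)
  rwa [Module.Basis.constr_basis, LinearMap.comp_apply, Submodule.subtype_apply,
    Module.Basis.span_apply] at this

/-- Linear compactness of an inverse limit of finite-dimensional spaces: a functional on the full
dual is given by evaluation, on the functionals that factor through the projections. -/
theorem exists_eval_eq {π : ∀ i, A →ₗ[k] B i} [∀ i, FiniteDimensional k (B i)]
    {f : ∀ ⦃i j : ι⦄, i ≤ j → (B j →ₗ[k] B i)} (hf : ∀ i j (h : i ≤ j), f h ∘ₗ π j = π i)
    (hcompl : ∀ x : ∀ i, B i, (∀ i j (h : i ≤ j), f h (x j) = x i) → ∃ a, ∀ i, π i a = x i)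
    (φ : Module.Dual k (Module.Dual k A)) :
    ∃ a : A, ∀ (w : Module.Dual k A) (i : ι), LinearMap.ker (π i) ≤ LinearMap.ker w →
      φ w = w a := by
  -- Reflexivity of the finite-dimensional `B i` turns `φ`, restricted to its dual, into a vector `b
  -- i`.
  choose b hb using fun i => (Module.evalEquiv k (B i)).surjective (φ ∘ₗ (π i).dualMap)
  have hb' : ∀ i (v : Module.Dual k (B i)), v (b i) = φ (v ∘ₗ π i) := fun i v => by
    exact LinearMap.congr_fun (hb i) v
  obtain ⟨a, ha⟩ := hcompl b fun i j h => by
    refine (Module.forall_dual_apply_eq_zero_iff k _).1 (fun v => ?_) |> sub_eq_zero.1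
    have := hb' j (v ∘ₗ f h)
    rw [LinearMap.comp_assoc, hf, ← hb' i] at this
    simpa [sub_eq_zero] using this
  refine ⟨a, fun w i hw => ?_⟩
  have : w ∈ LinearMap.range (π i).dualMap := by
    rw [LinearMap.range_dualMap_eq_dualAnnihilator_ker, Submodule.mem_dualAnnihilator]
    exact fun x hx => hw hx
  obtain ⟨v, rfl⟩ := this
  rw [LinearMap.dualMap_apply', ← hb' i, LinearMap.comp_apply, ha]

omit [Preorder ι] in
/-- A left annihilator is an intersection of kernels of continuous functionals. -/
theorem IsLeftDRing.exists_functional (hD : IsLeftDRing A) {π : ∀ i, A →ₗ[k] B i}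
    (hmul : ∀ i a b, π i a = 0 → π i (a * b) = 0) (hsep : ∀ a, (∀ i, π i a = 0) → a = 0)
    (I : Ideal A) {y : A} (hy : y ∉ I) :
    ∃ (w : Module.Dual k A) (i : ι), LinearMap.ker (π i) ≤ LinearMap.ker w ∧
      (∀ x ∈ I, w x = 0) ∧ w y ≠ 0 := by
  obtain ⟨S, hS⟩ := hD I
  obtain ⟨s, hs, hys⟩ : ∃ s ∈ S, y * s ≠ 0 := by
    by_contra! h
    exact hy ((hS y).2 h)
  obtain ⟨i, hi⟩ : ∃ i, π i (y * s) ≠ 0 := by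
    by_contra! h
    exact hys (hsep _ h)
  obtain ⟨v, hv⟩ : ∃ v : Module.Dual k (B i), v (π i (y * s)) ≠ 0 := by
    by_contra! h
    exact hi ((Module.forall_dual_apply_eq_zero_iff k _).1 h)
  refine ⟨v ∘ₗ π i ∘ₗ LinearMap.mulRight k s, i, fun a ha => ?_, fun x hx => ?_, by simpa using hv⟩
  · simp [hmul i a s ha]
  · simp [(hS x).1 hx s hs]

theorem IsLeftDRing.isNoetherianRing (hD : IsLeftDRing A) {π : ∀ i, A →ₗ[k] B i}
    [∀ i, FiniteDimensional k (B i)]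
    {f : ∀ ⦃i j : ι⦄, i ≤ j → (B j →ₗ[k] B i)} (hf : ∀ i j (h : i ≤ j), f h ∘ₗ π j = π i)
    (hcompl : ∀ x : ∀ i, B i, (∀ i j (h : i ≤ j), f h (x j) = x i) → ∃ a, ∀ i, π i a = x i)
    (hmul : ∀ i a b, π i a = 0 → π i (a * b) = 0) (hsep : ∀ a, (∀ i, π i a = 0) → a = 0) :
    IsNoetherian A A := by
  rw [isNoetherian_iff, RelEmbedding.wellFounded_iff_isEmpty]
  refine ⟨fun g => ?_⟩
  have hmono : StrictMono g := fun m n h => g.map_rel_iff.2 h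
  choose x hx hxn using fun n : ℕ => SetLike.exists_of_lt (hmono n.lt_succ_self)
  choose v i hker hv hvx using fun n => hD.exists_functional hmul hsep (g n) (hxn n)
  let I : Ideal A := ⨆ n, g n
  let R : Submodule k A := I.restrictScalars k
  have hxI : ∀ n, x n ∈ R := fun n => (le_iSup (fun n => g n) (n + 1)) (hx n)
  -- Triangularity: for `n < m`, `x n` lies in `g (n + 1) ≤ g m`, where `v m` vanishes. The value
  -- `1` on every `v n` is incompatible with evaluation at a point of any `g n`.
  obtain ⟨ψ, hψ⟩ := exists_dual_eq_one_of_triangular (fun n => (v n).domRestrict R)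
    (fun n => ⟨x n, hxI n⟩) (fun n => hvx n)
    (fun m n hmn => hv m _ (hmono.monotone hmn (hx n)))
  obtain ⟨y, hy⟩ := exists_eval_eq hf hcompl (ψ ∘ₗ R.subtype.dualMap)
  have hyv : ∀ n, v n y = 1 := fun n => (hy _ _ (hker n)).symm.trans (hψ n)
  -- Continuous functionals vanishing on `I` restrict to zero on `R`, so they vanish at `y`; and `I`
  -- is closed.
  have hyI : y ∈ I := by
    by_contra hyI
    obtain ⟨w, j, hwj, hwI, hwy⟩ := hD.exists_functional hmul hsep I hyI
    refine hwy ((hy _ _ hwj).symm.trans ?_)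
    have : R.subtype.dualMap w = 0 := LinearMap.ext fun z => hwI _ z.2
    rw [LinearMap.comp_apply, this, map_zero]
  obtain ⟨n, hn⟩ := (Submodule.mem_iSup_of_directed _ hmono.monotone.directed_le).1 hyI
  exact one_ne_zero ((hyv n).symm.trans (hv n y hn))

theorem IsLeftDRing.finiteDimensional (hD : IsLeftDRing A) [IsDirectedOrder ι] [Nonempty ι]
    {π : ∀ i, A →ₗ[k] B i} [∀ i, FiniteDimensional k (B i)]
    {f : ∀ ⦃i j : ι⦄, i ≤ j → (B j →ₗ[k] B i)} (hf : ∀ i j (h : i ≤ j), f h ∘ₗ π j = π i)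
    (hcompl : ∀ x : ∀ i, B i, (∀ i j (h : i ≤ j), f h (x j) = x i) → ∃ a, ∀ i, π i a = x i)
    (hmul : ∀ i a b, π i a = 0 → π i (a * b) = 0) (hmul' : ∀ i a b, π i b = 0 → π i (a * b) = 0)
    (hsep : ∀ a, (∀ i, π i a = 0) → a = 0) :
    FiniteDimensional k A := by
  have := hD.isNoetherianRing hf hcompl hmul hsep
  let U : ι → Ideal A := fun i =>
    { carrier := {a | π i a = 0}
      add_mem' := fun ha hb => (map_add _ _ _).trans (by
        rw [show π i _ = 0 from ha, show π i _ = 0 from hb, add_zero])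
      zero_mem' := map_zero _
      smul_mem' := fun c x hx => hmul' i c x hx }
  have hU : ∀ i j, i ≤ j → U j ≤ U i := fun i j h a (ha : π j a = 0) => by
    change π i a = 0
    rw [← hf i j h, LinearMap.comp_apply, ha, map_zero]
  -- `U i` is two-sided, so its right annihilator is a left ideal, to which the noetherian condition
  -- applies.
  let N : ι → Ideal A := fun i =>
    { carrier := {a | a ∈ rightAnn (U i : Set A)}
      add_mem' := fun ha hb => (rightAnn (U i : Set A)).add_mem ha hb
      zero_mem' := (rightAnn (U i : Set A)).zero_mem
      smul_mem' := fun c x hx u hu => by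
        rw [smul_eq_mul, ← mul_assoc]
        exact hx _ (hmul i u c hu) }
  obtain ⟨_, ⟨m, rfl⟩, hm⟩ := set_has_maximal_iff_noetherian.2 this (Set.range N)
    (Set.range_nonempty N)
  have hle : ∀ i, U m ≤ U i := fun i => by
    obtain ⟨j, hmj, hij⟩ := exists_ge_ge m i
    have hN : N m = N j := by
      by_contra hne
      exact hm (N j) ⟨j, rfl⟩ (lt_of_le_of_ne (fun a ha u hu => ha u (hU m j hmj hu)) hne)
    -- `U m` kills `N m = N j`, so it lies in the double annihilator of `U j`.
    refine le_trans (fun a ha => isLeftDRing_iff.1 hD (U j) fun x hx => ?_) (hU i j hij)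
    have : x ∈ N m := hN ▸ hx
    exact this a ha
  refine FiniteDimensional.of_injective (π m) ((injective_iff_map_eq_zero _).2 fun a ha => ?_)
  exact hsep a fun i => hle i ha

end Profinite

/-- A profinite algebra that is a left or a right D-ring is finite-dimensional. -/
theorem IsProfiniteAlgebra.finiteDimensional {k : Type*} [Field k] {A : Type u} [Ring A]
    [Algebra k A] (hA : IsProfiniteAlgebra.{w, v} k A) (hD : IsLeftDRing A ∨ IsRightDRing A) :
    FiniteDimensional k A := by
  obtain ⟨ι, _, _, _, B, _, _, f, _, -, -, ⟨e⟩⟩ := hA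
  let π : ∀ i, A →ₗ[k] B i := fun i =>
    ((Pi.evalAlgHom k B i).comp ((Subalgebra.val _).comp e.toAlgHom)).toLinearMap
  have hπ : ∀ i a, π i a = (e a).1 i := fun _ _ => rfl
  have hf : ∀ i j (h : i ≤ j), (f h).toLinearMap ∘ₗ π j = π i := fun i j h =>
    LinearMap.ext fun a => (e a).2 i j h
  have hcompl : ∀ x : ∀ i, B i, (∀ i j (h : i ≤ j), (f h).toLinearMap (x j) = x i) →
      ∃ a, ∀ i, π i a = x i := fun x hx =>
    ⟨e.symm ⟨x, hx⟩, fun i => by rw [hπ, e.apply_symm_apply]⟩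
  have hmul : ∀ i a b, π i (a * b) = π i a * π i b := fun i a b => by simp [hπ]
  have hsep : ∀ a, (∀ i, π i a = 0) → a = 0 := fun a ha =>
    e.injective (Subtype.ext (funext fun i => by rw [← hπ, ha, map_zero]; rfl))
  rcases hD with hD | hD
  · exact hD.finiteDimensional hf hcompl (fun i a b h => by rw [hmul, h, zero_mul])
      (fun i a b h => by rw [hmul, h, mul_zero]) hsep
  · have e' : Aᵐᵒᵖ ≃ₗ[k] A := (MulOpposite.opLinearEquiv k).symm
    have := IsLeftDRing.finiteDimensional (A := Aᵐᵒᵖ) (isLeftDRing_mulOpposite.2 hD)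
      (π := fun i => π i ∘ₗ (MulOpposite.opLinearEquiv k : A ≃ₗ[k] Aᵐᵒᵖ).symm.toLinearMap)
      (f := fun i j h => (f h).toLinearMap)
      (fun i j h => by rw [← LinearMap.comp_assoc, hf])
      (fun x hx => by
        obtain ⟨a, ha⟩ := hcompl x hx
        exact ⟨MulOpposite.op a, ha⟩)
      (fun i a b h => (hmul i b.unop a.unop).trans (by
        rw [show π i a.unop = 0 from h, mul_zero]))
      (fun i a b h => (hmul i b.unop a.unop).trans (by
        rw [show π i b.unop = 0 from h, zero_mul]))
      (fun a ha => MulOpposite.unop_injective (hsep _ ha))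
    exact Module.Finite.equiv (MulOpposite.opLinearEquiv k : A ≃ₗ[k] Aᵐᵒᵖ).symm

/-! ### Primitive idempotents modulo an ideal. -/

section Frame

variable {A ι : Type*} [Ring A]

/-- Elements `e i` which, modulo the ideal `J`, form a family of primitive idempotents, one for
each isomorphism class of simple modules over `A ⧸ J`. -/
structure IsBasicFrame (J : Ideal A) (e : ι → A) : Prop where
  notMem : ∀ i, e i ∉ J
  idem : ∀ i, e i * e i - e i ∈ J
  orth : ∀ i j, i ≠ j → ∀ a, e i * a * e j ∈ J
  exists_right : ∀ i a, e i * a ∉ J → ∃ b, e i * a * b - e i ∈ J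
  exists_left : ∀ i a, a * e i ∉ J → ∃ b, b * (a * e i) - e i ∈ J
  full : ∀ N : AddSubgroup A, (∀ a ∈ J, a ∈ N) → (∀ i a b, a * e i * b ∈ N) → 1 ∈ N

/-- The matrix units of position `(0, 0)` in a product of matrix rings over division rings. -/
theorem isBasicFrame_pi_matrix {n : ℕ} {D : Fin n → Type*} {d : Fin n → ℕ}
    [∀ i, DivisionRing (D i)] [∀ i, NeZero (d i)] :
    IsBasicFrame (⊥ : Ideal (Π i, Matrix (Fin (d i)) (Fin (d i)) (D i)))
      (fun i => Pi.single i (Matrix.single 0 0 1)) where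
  notMem i h := by
    have := congrFun (congrFun (congrFun (Ideal.mem_bot.1 h) i) 0) 0
    simp at this
  idem i := by
    rw [← Pi.single_mul, Matrix.single_mul_single_same, mul_one, sub_self]
    exact zero_mem _
  orth i j hij a := by
    rw [Ideal.mem_bot]
    funext t
    by_cases h : t = i
    · subst h
      simp [Pi.single_eq_of_ne hij]
    · simp [Pi.single_eq_of_ne h]
  exists_right i a ha := by
    obtain ⟨t, ht⟩ : ∃ t, a i 0 t ≠ 0 := by
      by_contra! h
      refine ha ((Ideal.mem_bot).2 (funext fun j => ?_))
      by_cases hj : j = i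
      · subst hj
        ext r s
        rcases eq_or_ne r 0 with rfl | hr
        · simp [h]
        · simp [Matrix.single_mul_apply_of_ne _ _ _ _ _ hr]
      · simp [Pi.single_eq_of_ne hj]
    refine ⟨Pi.single i (Matrix.single t 0 (a i 0 t)⁻¹), ?_⟩
    rw [Ideal.mem_bot, sub_eq_zero]
    funext j
    by_cases hj : j = i
    · subst hj
      simp [Matrix.single_mul_mul_single, ht]
    · simp [Pi.single_eq_of_ne hj]
  exists_left i a ha := by
    obtain ⟨t, ht⟩ : ∃ t, a i t 0 ≠ 0 := by
      by_contra! h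
      refine ha ((Ideal.mem_bot).2 (funext fun j => ?_))
      by_cases hj : j = i
      · subst hj
        ext r s
        rcases eq_or_ne s 0 with rfl | hr
        · simp [h]
        · simp [Matrix.mul_single_apply_of_ne _ _ _ _ _ hr]
      · simp [Pi.single_eq_of_ne hj]
    refine ⟨Pi.single i (Matrix.single 0 t (a i t 0)⁻¹), ?_⟩
    rw [Ideal.mem_bot, sub_eq_zero]
    funext j
    by_cases hj : j = i
    · subst hj
      simp [← mul_assoc, Matrix.single_mul_mul_single, ht]
    · simp [Pi.single_eq_of_ne hj]
  full N _ hN := by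
    have h1 : (1 : Π i, Matrix (Fin (d i)) (Fin (d i)) (D i)) =
        ∑ i : Fin n, Pi.single i (1 : Matrix (Fin (d i)) (Fin (d i)) (D i)) :=
      (Finset.univ_sum_single _).symm
    rw [h1]
    refine N.sum_mem fun i _ => ?_
    have h2 : (Pi.single i (1 : Matrix (Fin (d i)) (Fin (d i)) (D i)) :
        Π i, Matrix (Fin (d i)) (Fin (d i)) (D i)) =
        ∑ s : Fin (d i), Pi.single i (Matrix.single s 0 1) * Pi.single i (Matrix.single 0 0 1) *
          Pi.single i (Matrix.single 0 s 1) := by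
      simp only [← Pi.single_mul, Matrix.single_mul_single_same, mul_one]
      exact (congrArg _ Matrix.sum_single_one.symm).trans
        (map_sum (AddMonoidHom.single (fun i => Matrix (Fin (d i)) (Fin (d i)) (D i)) i) _ _)
    rw [h2]
    exact N.sum_mem fun s _ => hN i _ _

/-- All conditions are congruences, so arbitrary preimages work and no lifting of idempotents is
needed. -/
theorem IsBasicFrame.of_surjective {Q : Type*} [Ring Q] (ρ : A →+* Q)
    (hρ : Function.Surjective ρ) {ε : ι → Q} (hε : IsBasicFrame (⊥ : Ideal Q) ε) :
    ∃ e : ι → A, IsBasicFrame (RingHom.ker ρ) e := by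
  choose e he using fun i => hρ (ε i)
  have hk : ∀ a, a ∈ RingHom.ker ρ ↔ ρ a ∈ (⊥ : Ideal Q) := fun a => by
    rw [RingHom.mem_ker, Ideal.mem_bot]
  refine ⟨e, ?_, ?_, ?_, ?_, ?_, ?_⟩
  · intro i
    simpa [hk, he] using hε.notMem i
  · intro i
    simpa [hk, he] using hε.idem i
  · intro i j hij a
    simpa [hk, he] using hε.orth i j hij (ρ a)
  · intro i a ha
    obtain ⟨b, hb⟩ := hε.exists_right i (ρ a) (by simpa [hk, he] using ha)
    obtain ⟨b, rfl⟩ := hρ b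
    exact ⟨b, by simpa [hk, he] using hb⟩
  · intro i a ha
    obtain ⟨b, hb⟩ := hε.exists_left i (ρ a) (by simpa [hk, he] using ha)
    obtain ⟨b, rfl⟩ := hρ b
    exact ⟨b, by simpa [hk, he] using hb⟩
  · intro N hJ hN
    obtain ⟨x, hx, hx1⟩ := hε.full (N.map ρ.toAddMonoidHom)
      (fun a ha => by rw [(Ideal.mem_bot).1 ha]; exact zero_mem _)
      (fun i a b => by
        obtain ⟨a, rfl⟩ := hρ a
        obtain ⟨b, rfl⟩ := hρ b
        exact ⟨a * e i * b, hN i a b, by simp [he]⟩)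
    have : 1 - x ∈ N := hJ _ (by
      rw [RingHom.mem_ker, map_sub, map_one]
      exact sub_eq_zero.2 hx1.symm)
    simpa using N.add_mem this hx

theorem exists_isBasicFrame_jacobson [IsArtinianRing A] :
    ∃ (n : ℕ) (e : Fin n → A), IsBasicFrame (Ring.jacobson A) e := by
  obtain ⟨n, D, d, _, _, _, ⟨φ⟩⟩ :=
    IsSemisimpleRing.exists_algEquiv_pi_matrix_divisionRing ℤ (A ⧸ Ring.jacobson A)
  let ρ : A →+* _ := φ.toRingEquiv.toRingHom.comp (Ideal.Quotient.mk (Ring.jacobson A))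
  obtain ⟨e, he⟩ := IsBasicFrame.of_surjective ρ
    (φ.surjective.comp Ideal.Quotient.mk_surjective) isBasicFrame_pi_matrix
  have hker : RingHom.ker ρ = Ring.jacobson A := by
    ext a
    rw [RingHom.mem_ker, ← Ideal.Quotient.eq_zero_iff_mem]
    exact map_eq_zero_iff φ φ.injective
  exact ⟨n, e, hker ▸ he⟩

/-- Take for `u` the component of `1` in a complement of `K`: then `u * x` lies in both summands. -/
theorem IsSemisimpleRing.exists_mul_eq_zero_of_notMem [IsSemisimpleRing A]
    (K : Submodule Aᵐᵒᵖ A) (hK : 1 ∉ K) : ∃ u : A, u ≠ 0 ∧ ∀ x ∈ K, u * x = 0 := by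
  have : IsSemisimpleModule Aᵐᵒᵖ A :=
    .congr (MulOpposite.opLinearEquiv Aᵐᵒᵖ : A ≃ₗ[Aᵐᵒᵖ] Aᵐᵒᵖ)
  obtain ⟨K', hK'⟩ := exists_isCompl K
  obtain ⟨a, ha, u, hu, hau⟩ := Submodule.mem_sup.1
    (hK'.sup_eq_top ▸ Submodule.mem_top : (1 : A) ∈ K ⊔ K')
  refine ⟨u, ?_, fun x hx => ?_⟩
  · rintro rfl
    exact hK (by rwa [← hau, add_zero])
  · have h1 : u * x ∈ K' := K'.smul_mem (MulOpposite.op x) hu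
    have h2 : u * x ∈ K := by
      have : u * x = x - a * x := by rw [eq_sub_iff_add_eq', ← add_mul, hau, one_mul]
      rw [this]
      exact K.sub_mem hx (K.smul_mem (MulOpposite.op x) ha)
    exact (Submodule.mem_bot Aᵐᵒᵖ).1 (hK'.inf_eq_bot ▸ ⟨h2, h1⟩)

/-- A proper right ideal of a ring that is semisimple modulo `J` is killed modulo `J` by some
element, provided that it stays proper modulo `J`. -/
theorem exists_mul_mem_of_isSemisimpleRing_quotient (J : Ideal A) [J.IsTwoSided]
    [IsSemisimpleRing (A ⧸ J)] (W : Submodule Aᵐᵒᵖ A) (hW : ∀ w ∈ W, 1 - w ∉ J) :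
    ∃ u, u ∉ J ∧ ∀ w ∈ W, u * w ∈ J := by
  let K : Submodule (A ⧸ J)ᵐᵒᵖ (A ⧸ J) :=
    { W.toAddSubmonoid.map (Ideal.Quotient.mk J) with
      smul_mem' := by
        rintro c _ ⟨w, hw, rfl⟩
        obtain ⟨c, rfl⟩ := MulOpposite.op_surjective c
        obtain ⟨c, rfl⟩ := Ideal.Quotient.mk_surjective c
        exact ⟨w * c, W.smul_mem (MulOpposite.op c) hw, map_mul _ _ _⟩ }
  obtain ⟨u, hu, huK⟩ := IsSemisimpleRing.exists_mul_eq_zero_of_notMem K (by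
    rintro ⟨w, hw, hw1⟩
    refine hW w hw (Ideal.Quotient.eq_zero_iff_mem.1 ?_)
    rw [map_sub, map_one]
    exact sub_eq_zero.2 hw1.symm)
  obtain ⟨u, rfl⟩ := Ideal.Quotient.mk_surjective u
  refine ⟨u, fun h => hu (Ideal.Quotient.eq_zero_iff_mem.2 h), fun w hw => ?_⟩
  rw [← Ideal.Quotient.eq_zero_iff_mem, map_mul]
  exact huK _ ⟨w, hw, rfl⟩

end Frame

/-! ### Corners of the two-sided socle. -/

section Corner

variable {A ι : Type*} [Ring A] {J : Ideal A} {e : ι → A}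

/-- Every nonzero element of a ring with nilpotent ideal `J` has a nonzero right multiple killed by
`J` on the right. -/
theorem exists_mul_ne_zero_of_isNilpotent (hJ : IsNilpotent J) {y : A} (hy : y ≠ 0) :
    ∃ a, y * a ≠ 0 ∧ ∀ c ∈ J, y * a * c = 0 := by
  by_contra! h
  obtain ⟨n, hn⟩ := hJ
  have key : ∀ m, ∃ a ∈ J ^ m, y * a ≠ 0 := fun m => by
    induction m with
    | zero => exact ⟨1, by rw [Submodule.pow_zero, Ideal.one_eq_top]; trivial, by simpa using hy⟩
    | succ m ih =>
      obtain ⟨a, ha, hya⟩ := ih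
      obtain ⟨c, hc, hyc⟩ := h a hya
      exact ⟨a * c, by rw [Submodule.pow_succ]; exact Ideal.mul_mem_mul ha hc, by rwa [← mul_assoc]⟩
  obtain ⟨a, ha, hya⟩ := key n
  rw [hn] at ha
  exact hya (by rw [show a = 0 from ha, mul_zero])

theorem isNilpotent_of_mem_of_isNilpotent (hJ : IsNilpotent J) {a : A} (ha : a ∈ J) :
    IsNilpotent a := by
  obtain ⟨n, hn⟩ := hJ
  have : a ^ n ∈ J ^ n := Ideal.pow_mem_pow ha n
  exact ⟨n, by rwa [hn] at this⟩

theorem isUnit_of_one_sub_mem (hJ : IsNilpotent J) {a : A} (ha : 1 - a ∈ J) : IsUnit a := by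
  simpa using (isNilpotent_of_mem_of_isNilpotent hJ ha).isUnit_one_sub

/-- On elements killed by `J`, multiplication depends only on classes modulo `J`, so inverses modulo
`J` act as true inverses. -/
theorem IsBasicFrame.exists_mul_mul_eq_left (he : IsBasicFrame J e) {i : ι} {x a : A}
    (hx : ∀ c ∈ J, c * x = 0) (hi : e i * x = x) (ha : a * x ≠ 0) : ∃ b, b * (a * x) = x := by
  obtain ⟨b, hb⟩ := he.exists_left i a fun h => ha (by rw [← hi, ← mul_assoc, hx _ h])
  refine ⟨b, ?_⟩
  have := hx _ hb
  rwa [sub_mul, hi, sub_eq_zero, mul_assoc, mul_assoc, hi] at this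

theorem IsBasicFrame.exists_mul_mul_eq_right (he : IsBasicFrame J e) {j : ι} {x a : A}
    (hx : ∀ c ∈ J, x * c = 0) (hj : x * e j = x) (ha : x * a ≠ 0) : ∃ b, x * a * b = x := by
  obtain ⟨b, hb⟩ := he.exists_right j a fun h => ha (by rw [← hj, mul_assoc, hx _ h])
  refine ⟨b, ?_⟩
  have := hx _ hb
  rwa [mul_sub, hj, sub_eq_zero, ← mul_assoc, ← mul_assoc, hj] at this

variable (k : Type*) [Field k] [Algebra k A]

/-- The part of the two-sided socle `{x | J x = 0 = x J}` cut out by `e i` on the left and `e j`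
on the right. -/
def socleCorner (J : Ideal A) (e : ι → A) (i j : ι) : Submodule k A where
  carrier := {x | (∀ c ∈ J, c * x = 0) ∧ (∀ c ∈ J, x * c = 0) ∧ e i * x = x ∧ x * e j = x}
  add_mem' := by
    rintro x y ⟨h1, h2, h3, h4⟩ ⟨g1, g2, g3, g4⟩
    exact ⟨fun c hc => by rw [mul_add, h1 c hc, g1 c hc, add_zero],
      fun c hc => by rw [add_mul, h2 c hc, g2 c hc, add_zero],
      by rw [mul_add, h3, g3], by rw [add_mul, h4, g4]⟩
  zero_mem' := by simp
  smul_mem' := by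
    rintro t x ⟨h1, h2, h3, h4⟩
    exact ⟨fun c hc => by rw [mul_smul_comm, h1 c hc, smul_zero],
      fun c hc => by rw [smul_mul_assoc, h2 c hc, smul_zero],
      by rw [mul_smul_comm, h3], by rw [smul_mul_assoc, h4]⟩

variable {k}

theorem IsBasicFrame.mul_mem_socleCorner [J.IsTwoSided] (he : IsBasicFrame J e) {i : ι} (j : ι)
    {y : A} (a : A) (hl : ∀ c ∈ J, c * y = 0) (hr : ∀ c ∈ J, y * c = 0) (hi : e i * y = y) :
    y * a * e j ∈ socleCorner k J e i j := by
  refine ⟨fun c hc => ?_, fun c hc => ?_, ?_, ?_⟩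
  · rw [← mul_assoc, ← mul_assoc, hl c hc, zero_mul, zero_mul]
  · rw [mul_assoc, mul_assoc]
    exact hr _ (J.mul_mem_left _ (J.mul_mem_left _ hc))
  · rw [← mul_assoc, ← mul_assoc, hi]
  · have := hr _ (J.mul_mem_left a (he.idem j))
    rw [mul_sub, mul_sub, sub_eq_zero] at this
    simpa only [mul_assoc] using this

variable (k)

/-- As `J` is its own double annihilator, `e i ∉ J` gives `y` with `J y = 0` and `e i * y ≠ 0`. A
right multiple is killed by `J` on the right too, and by `full` not all its corner components
vanish. -/
theorem IsBasicFrame.exists_socleCorner_ne_zero [J.IsTwoSided] (hD : IsLeftDRing A)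
    (he : IsBasicFrame J e) (hJ : IsNilpotent J) (i : ι) :
    ∃ j, ∃ x ∈ socleCorner k J e i j, x ≠ 0 := by
  obtain ⟨y, hy, hy0⟩ : ∃ y, (∀ c ∈ J, c * y = 0) ∧ e i * y ≠ 0 := by
    by_contra! h
    exact he.notMem i (isLeftDRing_iff.1 hD J fun y hy => h y hy)
  have hl : ∀ c ∈ J, c * (e i * y) = 0 := fun c hc => by
    rw [← mul_assoc, hy _ (J.mul_mem_right _ hc)]
  have hi : e i * (e i * y) = e i * y := by
    have := hy _ (he.idem i)
    rwa [sub_mul, sub_eq_zero, mul_assoc] at this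
  obtain ⟨a, ha0, ha⟩ := exists_mul_ne_zero_of_isNilpotent hJ hy0
  by_contra! h
  refine ha0 ?_
  have hl' : ∀ c ∈ J, c * (e i * y * a) = 0 := fun c hc => by
    rw [← mul_assoc, hl c hc, zero_mul]
  have hi' : e i * (e i * y * a) = e i * y * a := by rw [← mul_assoc, hi]
  have := he.full (AddMonoidHom.mulLeft (e i * y * a)).ker ha fun j b b' => by
    rw [AddMonoidHom.mem_ker, AddMonoidHom.coe_mulLeft, ← mul_assoc, ← mul_assoc,
      h j _ (he.mul_mem_socleCorner j b hl' ha hi'), zero_mul]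
  simpa using this

variable {k}

/-- If `x * a = 0` then `e j * a ∈ J`, since otherwise an inverse modulo `J` would give `x = 0`.
Hence `y * a = 0`, and `IsLeftDRing.exists_eq_mul` applies. -/
theorem IsBasicFrame.exists_eq_mul_of_mem_socleCorner (hD : IsLeftDRing A)
    (he : IsBasicFrame J e) {i j : ι} {x y : A} (hx : x ∈ socleCorner k J e i j) (hx0 : x ≠ 0)
    (hy : ∀ c ∈ J, y * c = 0) (hyj : y * e j = y) : ∃ c, y = c * x := by
  obtain ⟨-, hr, -, hj⟩ := hx
  refine hD.exists_eq_mul fun a hxa => ?_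
  by_cases ha : e j * a ∈ J
  · rw [← hyj, mul_assoc, hy _ ha]
  · obtain ⟨b, hb⟩ := he.exists_right j a ha
    have := hr _ hb
    rw [mul_sub, hj, ← mul_assoc, ← mul_assoc, hj, hxa, zero_mul, zero_sub, neg_eq_zero] at this
    exact absurd this hx0

/-- Here `y = c * x = e i' * c * e i * x`, and an off-diagonal `e i' * c * e i` lies in `J`, which
kills `x`. -/
theorem IsBasicFrame.eq_of_socleCorner_ne_zero (hD : IsLeftDRing A) (he : IsBasicFrame J e)
    {i i' j : ι} {x y : A} (hx : x ∈ socleCorner k J e i j) (hx0 : x ≠ 0)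
    (hy : y ∈ socleCorner k J e i' j) (hy0 : y ≠ 0) : i' = i := by
  obtain ⟨c, rfl⟩ := he.exists_eq_mul_of_mem_socleCorner hD hx hx0 hy.2.1 hy.2.2.2
  by_contra hne
  refine hy0 ?_
  rw [← hy.2.2.1, ← hx.2.2.1, ← mul_assoc, ← mul_assoc, hx.1 _ (he.orth i' i hne c)]

/-- The socle corners form a permutation pattern, and the nonzero ones are generated on the right
by any nonzero element. -/
theorem IsBasicFrame.exists_perm [J.IsTwoSided] [Fintype ι] [FiniteDimensional k A]
    (hD : IsLeftDRing A) (he : IsBasicFrame J e) (hJ : IsNilpotent J) :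
    ∃ (σ : ι → ι) (x : ι → A), Function.Bijective σ ∧
      (∀ i, x i ∈ socleCorner k J e i (σ i)) ∧ (∀ i, x i ≠ 0) ∧
      ∀ i, ∀ y ∈ socleCorner k J e i (σ i), ∃ a, y = x i * a := by
  choose σ x hx hx0 using he.exists_socleCorner_ne_zero k hD hJ
  have hinj : Function.Injective σ := fun i i' h =>
    (he.eq_of_socleCorner_ne_zero hD (hx i) (hx0 i) (h ▸ hx i') (hx0 i')).symm
  have hbij : Function.Bijective σ := Finite.injective_iff_bijective.1 hinj
  refine ⟨σ, x, hbij, hx, hx0, ?_⟩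
  -- The range of `C i` is `e i A e i` modulo `J`. `F i` has the same kernel as `C i`, and `G i` the
  -- same kernel as `C (σ i)`, so ranks can be compared.
  let C : ι → A →ₗ[k] A ⧸ J.restrictScalars k := fun i =>
    (J.restrictScalars k).mkQ ∘ₗ LinearMap.mulLeft k (e i) ∘ₗ LinearMap.mulRight k (e i)
  have hC : ∀ i a, C i a = 0 ↔ e i * (a * e i) ∈ J := fun i a =>
    Submodule.Quotient.mk_eq_zero (J.restrictScalars k)
  let F : ι → A →ₗ[k] A := fun i => LinearMap.mulLeft k (e i) ∘ₗ LinearMap.mulRight k (x i)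
  let G : ι → A →ₗ[k] A := fun i => LinearMap.mulLeft k (x i) ∘ₗ LinearMap.mulRight k (e (σ i))
  have hF : ∀ i, LinearMap.ker (F i) = LinearMap.ker (C i) := fun i => by
    ext a
    rw [LinearMap.mem_ker, LinearMap.mem_ker, hC]
    change e i * (a * x i) = 0 ↔ _
    constructor
    · intro h
      by_contra hn
      rw [← mul_assoc] at hn
      obtain ⟨b, hb⟩ := he.exists_left i _ hn
      have := (hx i).1 _ hb
      rw [sub_mul, (hx i).2.2.1, sub_eq_zero] at this
      refine hx0 i (this.symm.trans ?_)
      rw [mul_assoc, mul_assoc, mul_assoc, (hx i).2.2.1, h, mul_zero]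
    · intro h
      have := (hx i).1 _ h
      rwa [mul_assoc, mul_assoc, (hx i).2.2.1] at this
  have hG : ∀ i, LinearMap.ker (G i) = LinearMap.ker (C (σ i)) := fun i => by
    ext a
    rw [LinearMap.mem_ker, LinearMap.mem_ker, hC]
    change x i * (a * e (σ i)) = 0 ↔ _
    constructor
    · intro h
      by_contra hn
      obtain ⟨b, hb⟩ := he.exists_right (σ i) _ hn
      have := (hx i).2.1 _ hb
      rw [mul_sub, (hx i).2.2.2, sub_eq_zero] at this
      refine hx0 i (this.symm.trans ?_)
      rw [← mul_assoc, ← mul_assoc, (hx i).2.2.2, h, zero_mul]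
    · intro h
      have := (hx i).2.1 _ h
      rwa [← mul_assoc, (hx i).2.2.2] at this
  have hGB : ∀ i, LinearMap.range (G i) ≤ socleCorner k J e i (σ i) := by
    rintro i _ ⟨a, rfl⟩
    have := he.mul_mem_socleCorner (k := k) (σ i) a (hx i).1 (hx i).2.1 (hx i).2.2.1
    rwa [mul_assoc] at this
  have hBF : ∀ i, socleCorner k J e i (σ i) ≤ LinearMap.range (F i) := by
    intro i y hy
    obtain ⟨c, rfl⟩ := he.exists_eq_mul_of_mem_socleCorner hD (hx i) (hx0 i) hy.2.1 hy.2.2.2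
    exact ⟨c, hy.2.2.1⟩
  have hF' : ∀ i, Module.finrank k (LinearMap.range (F i)) +
      Module.finrank k (LinearMap.ker (C i)) = Module.finrank k A := fun i => by
    rw [← hF, LinearMap.finrank_range_add_finrank_ker]
  have hG' : ∀ i, Module.finrank k (LinearMap.range (G i)) +
      Module.finrank k (LinearMap.ker (C (σ i))) = Module.finrank k A := fun i => by
    rw [← hG, LinearMap.finrank_range_add_finrank_ker]
  have hle : ∀ i, Module.finrank k (LinearMap.range (G i)) ≤
      Module.finrank k (LinearMap.range (F i)) := fun i =>
    Submodule.finrank_mono ((hGB i).trans (hBF i))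
  -- The corner lies between the ranges of `G i` and `F i`. As `σ` is a permutation the total ranks
  -- agree, so all these inclusions are equalities.
  have hsum : ∑ i, Module.finrank k (LinearMap.range (G i)) =
      ∑ i, Module.finrank k (LinearMap.range (F i)) := by
    have h1 : ∑ i, Module.finrank k (LinearMap.ker (C (σ i))) =
        ∑ i, Module.finrank k (LinearMap.ker (C i)) :=
      hbij.sum_comp fun i => Module.finrank k (LinearMap.ker (C i))
    have h2 := Finset.sum_congr rfl fun i (_ : i ∈ Finset.univ) => (hF' i).trans (hG' i).symm
    rw [Finset.sum_add_distrib, Finset.sum_add_distrib, h1] at h2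
    exact (Nat.add_right_cancel h2).symm
  intro i y hy
  have heq := (Finset.sum_eq_sum_iff_of_le fun i _ => hle i).1 hsum i (Finset.mem_univ i)
  have : LinearMap.range (G i) = LinearMap.range (F i) :=
    Submodule.eq_of_le_of_finrank_eq ((hGB i).trans (hBF i)) heq
  obtain ⟨a, rfl⟩ : y ∈ LinearMap.range (G i) := this ▸ hBF i hy
  exact ⟨_, rfl⟩

end Corner

/-! ### Annihilators of maximal one-sided ideals. -/

section Simple

variable {A : Type*} [Ring A]

/-- In a finite-dimensional left D-ring, the right annihilator of a maximal left ideal and the left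
annihilator of a maximal right ideal are simple or zero. -/
theorem IsLeftDRing.exists_eq_mul_of_mem_ann (k : Type*) [Field k] [Algebra k A]
    [FiniteDimensional k A] (hD : IsLeftDRing A) :
    (∀ M : Ideal A, IsCoatom M → ∀ y ∈ rightAnn (M : Set A), ∀ z ∈ rightAnn (M : Set A),
      y ≠ 0 → ∃ a, z = y * a) ∧
    (∀ K : Submodule Aᵐᵒᵖ A, IsCoatom K → ∀ y ∈ leftAnn (K : Set A), ∀ z ∈ leftAnn (K : Set A),
      y ≠ 0 → ∃ a, z = a * y) := by
  have : IsArtinianRing A := isArtinian_of_tower k inferInstance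
  obtain ⟨n, e, he⟩ := exists_isBasicFrame_jacobson (A := A)
  have hJ : IsNilpotent (Ring.jacobson A) := IsSemiprimaryRing.isNilpotent
  have : (Ring.jacobson A).IsTwoSided := inferInstance
  generalize hJJ : Ring.jacobson A = J at *
  have : IsSemisimpleRing (A ⧸ J) := by subst hJJ; infer_instance
  obtain ⟨σ, x, hσ, hx, hx0, hgen⟩ := he.exists_perm (k := k) hD hJ
  have hl : ∀ j y z, (∀ c ∈ J, y * c = 0) → y * e j = y → (∀ c ∈ J, z * c = 0) → z * e j = z →
      y ≠ 0 → ∃ a, z = a * y := by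
    intro j y z hy hyj hz hzj hy0
    obtain ⟨i, rfl⟩ := hσ.2 j
    obtain ⟨c, rfl⟩ := he.exists_eq_mul_of_mem_socleCorner hD (hx i) (hx0 i) hy hyj
    obtain ⟨d, rfl⟩ := he.exists_eq_mul_of_mem_socleCorner hD (hx i) (hx0 i) hz hzj
    obtain ⟨b, hb⟩ := he.exists_mul_mul_eq_left (hx i).1 (hx i).2.2.1 hy0
    exact ⟨d * b, by rw [mul_assoc, hb]⟩
  -- For `y ≠ 0` the right annihilator of `y` stays proper modulo `J`, so some `u ∉ J` sends it into
  -- `J`. A suitable `x i' * (q * u)` is nonzero and kills that annihilator, hence equals `c * y`.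
  -- Then `y` is a left multiple of it and, like it, is killed by `J` on the right.
  have hsoc : ∀ i y, (∀ c ∈ J, c * y = 0) → e i * y = y → ∀ c ∈ J, y * c = 0 := by
    intro i y hy hiy
    by_cases hy0 : y = 0
    · simp [hy0]
    obtain ⟨u, huJ, hu⟩ := exists_mul_mem_of_isSemisimpleRing_quotient J (rightAnn {y})
      fun w hw hw1 => hy0 (by
        have := hw y rfl
        exact (isUnit_of_one_sub_mem hJ hw1).mul_left_eq_zero.1 this)
    obtain ⟨j, q, hq⟩ : ∃ j q, e j * (q * u) ∉ J := by
      by_contra! h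
      have := he.full (J.toAddSubgroup.comap (AddMonoidHom.mulRight u))
        (fun a ha => J.mul_mem_right _ ha) fun i a b => by
          change a * e i * b * u ∈ J
          rw [mul_assoc, mul_assoc]
          exact J.mul_mem_left _ (h i b)
      exact huJ (by simpa using this)
    obtain ⟨i', rfl⟩ := hσ.2 j
    have hz0 : x i' * (q * u) ≠ 0 := fun h => by
      obtain ⟨b, hb⟩ := he.exists_right _ _ hq
      have := (hx i').2.1 _ hb
      rw [mul_sub, (hx i').2.2.2, ← mul_assoc, ← mul_assoc, (hx i').2.2.2, h, zero_mul, zero_sub,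
        neg_eq_zero] at this
      exact hx0 i' this
    obtain ⟨c, hc⟩ := hD.exists_eq_mul (x := y) (y := x i' * (q * u)) fun a ha => by
      rw [mul_assoc, mul_assoc]
      refine (hx i').2.1 _ (J.mul_mem_left _ (hu a ?_))
      rintro _ rfl
      exact ha
    obtain ⟨b, hb⟩ := he.exists_mul_mul_eq_left hy hiy (hc ▸ hz0)
    intro t ht
    rw [← hb, ← hc, mul_assoc, mul_assoc, (hx i').2.1 _ (J.mul_mem_left _ ht), mul_zero]
  have hr : ∀ i y z, (∀ c ∈ J, c * y = 0) → e i * y = y → (∀ c ∈ J, c * z = 0) → e i * z = z →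
      y ≠ 0 → ∃ a, z = y * a := by
    -- By `full` it suffices to treat `y * a * e j`. It lies in the corner `(i, j)`, which is zero
    -- unless `j = σ i`, and that corner is generated by `x i`.
    have key : ∀ i y, (∀ c ∈ J, c * y = 0) → e i * y = y → ∃ a, y = x i * a := by
      intro i y hy hiy
      have hyr := hsoc i y hy hiy
      let S : Submodule Aᵐᵒᵖ A := Submodule.span Aᵐᵒᵖ {x i}
      have hS : ∀ {s}, s ∈ S ↔ ∃ a, s = x i * a := by
        intro s
        rw [Submodule.mem_span_singleton]
        exact ⟨fun ⟨a, ha⟩ => ⟨a.unop, ha.symm⟩, fun ⟨a, ha⟩ => ⟨MulOpposite.op a, ha.symm⟩⟩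
      have := he.full (S.toAddSubgroup.comap (AddMonoidHom.mulLeft y))
        (fun a ha => by
          change y * a ∈ S
          rw [hyr a ha]
          exact S.zero_mem)
        (fun j a b => by
          change y * (a * e j * b) ∈ S
          rw [← mul_assoc, ← mul_assoc]
          refine S.smul_mem (MulOpposite.op b) ?_
          have hm := he.mul_mem_socleCorner (k := k) j a hy hyr hiy
          by_cases h0 : y * a * e j = 0
          · rw [h0]
            exact S.zero_mem
          obtain ⟨i', rfl⟩ := hσ.2 j
          obtain rfl := he.eq_of_socleCorner_ne_zero hD (hx i') (hx0 i') hm h0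
          exact hS.2 (hgen _ _ hm))
      exact hS.1 (by simpa using this)
    intro i y z hy hiy hz hiz hy0
    obtain ⟨a, rfl⟩ := key i y hy hiy
    obtain ⟨c, rfl⟩ := key i z hz hiz
    obtain ⟨b, hb⟩ := he.exists_mul_mul_eq_right (hx i).2.1 (hx i).2.2.2 hy0
    exact ⟨b * c, by rw [← mul_assoc, hb]⟩
  constructor
  · intro M hM y hy z hz hy0
    have hJM : J ≤ M := by
      rw [← hJJ]
      have : M.IsMaximal := ⟨hM⟩
      exact Ring.jacobson_le_of_isMaximal M
    -- Left multiplication by `e i * b` will embed the right annihilator of `M` into the elements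
    -- handled by `hr`; it is injective because `M` and `e i * b` generate `A`.
    obtain ⟨i, b, hb⟩ : ∃ i b, e i * b ∉ M := by
      by_contra! h
      refine hM.1 ((Ideal.eq_top_iff_one M).2 ?_)
      refine he.full M.toAddSubgroup hJM fun i a b => ?_
      change a * e i * b ∈ M
      rw [mul_assoc]
      exact M.mul_mem_left a (h i b)
    have hunit : ∀ t ∈ rightAnn (M : Set A), e i * b * t = 0 → t = 0 := by
      intro t ht htb
      have h1 : (1 : A) ∈ M ⊔ Ideal.span {e i * b} := by
        have : M ⊔ Ideal.span {e i * b} = ⊤ := by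
          refine hM.2 _ (lt_of_le_of_ne le_sup_left fun h => hb ?_)
          rw [h]
          exact Ideal.mem_sup_right (Ideal.mem_span_singleton_self _)
        rw [this]
        trivial
      obtain ⟨m, hm, s, hs, hms⟩ := Submodule.mem_sup.1 h1
      obtain ⟨c, rfl⟩ := Ideal.mem_span_singleton'.1 hs
      rw [← one_mul t, ← hms, add_mul, ht m hm, mul_assoc, htb, mul_zero, add_zero]
    have hlJ : ∀ t ∈ rightAnn (M : Set A), ∀ c ∈ J, c * (e i * b * t) = 0 := by
      intro t ht c hc
      rw [← mul_assoc]
      exact ht _ (hJM (J.mul_mem_right _ hc))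
    have hli : ∀ t ∈ rightAnn (M : Set A), e i * (e i * b * t) = e i * b * t := by
      intro t ht
      have := ht _ (hJM (J.mul_mem_right b (he.idem i)))
      rw [sub_mul, sub_mul, sub_eq_zero] at this
      simpa only [mul_assoc] using this
    obtain ⟨a, ha⟩ := hr i _ _ (hlJ y hy) (hli y hy) (hlJ z hz) (hli z hz)
      fun h => hy0 (hunit y hy h)
    refine ⟨a, sub_eq_zero.1 (hunit _ (Submodule.sub_mem _ hz
      (Submodule.smul_mem _ (MulOpposite.op a) hy)) ?_)⟩
    rw [mul_sub, ha, mul_assoc _ y a, sub_self]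
  · intro K hK y hy z hz hy0
    -- Nakayama: otherwise `1 = m + a * c` with `m ∈ K` and `a * c ∈ J`, which makes `m` a unit.
    have hJK : ∀ a ∈ J, a ∈ K := by
      intro a ha
      by_contra haK
      have h1 : (1 : A) ∈ K ⊔ Submodule.span Aᵐᵒᵖ {a} := by
        have : K ⊔ Submodule.span Aᵐᵒᵖ {a} = ⊤ := by
          refine hK.2 _ (lt_of_le_of_ne le_sup_left fun h => haK ?_)
          rw [h]
          exact Submodule.mem_sup_right (Submodule.mem_span_singleton_self _)
        rw [this]
        trivial
      obtain ⟨m, hm, s, hs, hms⟩ := Submodule.mem_sup.1 h1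
      obtain ⟨c, rfl⟩ := Submodule.mem_span_singleton.1 hs
      obtain ⟨v, rfl⟩ : IsUnit m := isUnit_of_one_sub_mem hJ (by
        rw [← hms, add_sub_cancel_left]
        exact J.mul_mem_right _ ha)
      refine hK.1 (eq_top_iff.2 fun t _ => ?_)
      have := K.smul_mem (MulOpposite.op ((↑v⁻¹ : A) * t)) hm
      rwa [MulOpposite.smul_eq_mul_unop, MulOpposite.unop_op, Units.mul_inv_cancel_left] at this
    obtain ⟨j, b, hb⟩ : ∃ j b, b * e j ∉ K := by
      by_contra! h
      refine hK.1 (eq_top_iff.2 fun t _ => ?_)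
      have : (1 : A) ∈ K := he.full K.toAddSubgroup hJK fun i a b =>
        K.smul_mem (MulOpposite.op b) (h i a)
      simpa using K.smul_mem (MulOpposite.op t) this
    have hunit : ∀ t ∈ leftAnn (K : Set A), t * (b * e j) = 0 → t = 0 := by
      intro t ht htb
      have h1 : (1 : A) ∈ K ⊔ Submodule.span Aᵐᵒᵖ {b * e j} := by
        have : K ⊔ Submodule.span Aᵐᵒᵖ {b * e j} = ⊤ := by
          refine hK.2 _ (lt_of_le_of_ne le_sup_left fun h => hb ?_)
          rw [h]
          exact Submodule.mem_sup_right (Submodule.mem_span_singleton_self _)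
        rw [this]
        trivial
      obtain ⟨m, hm, s, hs, hms⟩ := Submodule.mem_sup.1 h1
      obtain ⟨c, rfl⟩ := Submodule.mem_span_singleton.1 hs
      rw [← mul_one t, ← hms, mul_add, ht m hm, MulOpposite.smul_eq_mul_unop, ← mul_assoc, htb,
        zero_mul, add_zero]
    have hrJ : ∀ t ∈ leftAnn (K : Set A), ∀ c ∈ J, t * (b * e j) * c = 0 := by
      intro t ht c hc
      rw [mul_assoc]
      exact ht _ (hJK _ (J.mul_mem_left _ hc))
    have hrj : ∀ t ∈ leftAnn (K : Set A), t * (b * e j) * e j = t * (b * e j) := by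
      intro t ht
      have := ht _ (hJK _ (J.mul_mem_left b (he.idem j)))
      rw [mul_sub, mul_sub, sub_eq_zero] at this
      simpa only [mul_assoc] using this
    obtain ⟨a, ha⟩ := hl j _ _ (hrJ y hy) (hrj y hy) (hrJ z hz) (hrj z hz)
      fun h => hy0 (hunit y hy h)
    refine ⟨a, sub_eq_zero.1 (hunit _ (Submodule.sub_mem _ hz
      (Submodule.smul_mem _ a hy)) ?_)⟩
    rw [sub_mul, ha, mul_assoc a y, sub_self]

end Simple

/-! ### Composition length and annihilators under a pairing. -/

section Length

variable {R S P Q Z : Type*} [Ring R] [Ring S] [AddCommGroup P] [Module R P] [AddCommGroup Q]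
  [Module S Q] [AddCommGroup Z] [Module R Z] [Module S Z]

/-- This left ideal is the annihilator of the class of `b`, which generates the simple module `I /
I'`. -/
theorem Submodule.isCoatom_comap_of_covBy {I' I : Submodule R P} (h : I' ⋖ I) {b : P}
    (hb : b ∈ I) (hb' : b ∉ I') : IsCoatom (I'.comap (LinearMap.toSpanSingleton R P b)) := by
  constructor
  · intro h1
    have : (1 : R) ∈ I'.comap (LinearMap.toSpanSingleton R P b) := h1 ▸ Submodule.mem_top
    rw [Submodule.mem_comap, LinearMap.toSpanSingleton_apply, one_smul] at this
    exact hb' this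
  · intro N hN
    obtain ⟨n, hn, hnM⟩ := SetLike.exists_of_lt hN
    have hnb : n • b ∉ I' := hnM
    have hsup : I' ⊔ Submodule.span R {n • b} = I :=
      (h.wcovBy.eq_or_eq le_sup_left (sup_le h.le ((Submodule.span_singleton_le_iff_mem _ _).2
        (I.smul_mem n hb)))).resolve_left fun h' => hnb (by
          rw [← h']
          exact Submodule.mem_sup_right (Submodule.mem_span_singleton_self _))
    obtain ⟨i, hi, s, hs, his⟩ := Submodule.mem_sup.1 (hsup.symm ▸ hb)
    obtain ⟨c, rfl⟩ := Submodule.mem_span_singleton.1 hs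
    have h1 : 1 - c * n ∈ N := hN.le (by
      rwa [Submodule.mem_comap, LinearMap.toSpanSingleton_apply, sub_smul, one_smul, mul_smul,
        ← eq_sub_of_add_eq his])
    have : (1 : R) ∈ N := by simpa using N.add_mem h1 (N.smul_mem c hn)
    exact (Ideal.eq_top_iff_one N).2 this

theorem CovBy.exists_sup_span_singleton_eq {I' I : Submodule R P} (h : I' ⋖ I) :
    ∃ b ∈ I, b ∉ I' ∧ I' ⊔ Submodule.span R {b} = I := by
  obtain ⟨b, hb, hb'⟩ := SetLike.exists_of_lt h.lt
  refine ⟨b, hb, hb', (h.wcovBy.eq_or_eq le_sup_left (sup_le h.le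
    ((Submodule.span_singleton_le_iff_mem _ _).2 hb))).resolve_left fun h' => hb' ?_⟩
  rw [← h']
  exact Submodule.mem_sup_right (Submodule.mem_span_singleton_self _)

theorem Module.length_le_one_of_forall_exists_smul (h : ∀ y z : P, y ≠ 0 → ∃ a : R, z = a • y) :
    Module.length R P ≤ 1 := by
  rcases subsingleton_or_nontrivial P with _ | _
  · rw [Module.length_eq_zero]
    exact zero_le_one
  · have : IsSimpleModule R P := isSimpleModule_iff_toSpanSingleton_surjective.2
      ⟨inferInstance, fun y hy z => (h y z hy).imp fun _ ha => ha.symm⟩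
    exact (Module.length_eq_one R P).le

theorem Module.length_le_of_ker_le (f : Q →ₗ[S] Z) :
    Module.length S Q ≤ Module.length S (LinearMap.ker f) + Module.length S Z := by
  rw [Module.length_eq_add_of_exact (LinearMap.ker f).subtype f.rangeRestrict
    (Submodule.subtype_injective _) f.surjective_rangeRestrict
    (fun x => by simp [Subtype.ext_iff])]
  gcongr
  exact Module.length_le_of_injective (LinearMap.range f).subtype (Submodule.subtype_injective _)

/-- The elements of `Q` that pair to zero with a subset of `P`. -/
def pairingAnn (β : P →+ Q →ₗ[S] Z) (s : Set P) : Submodule S Q where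
  carrier := {q | ∀ p ∈ s, β p q = 0}
  add_mem' ha hb p hp := by rw [map_add, ha p hp, hb p hp, add_zero]
  zero_mem' p _ := map_zero _
  smul_mem' c q hq p hp := by rw [map_smul, hq p hp, smul_zero]

/-- If annihilators of maximal left ideals are simple or zero, passing to annihilators decreases
the colength of submodules. -/
theorem length_pairingAnn_add_length_mono [IsNoetherian R P] [IsArtinian R P]
    (β : P →+ Q →ₗ[S] Z) (hβ : ∀ (r : R) p q, β (r • p) q = r • β p q)
    (hZ : ∀ M : Submodule R R, IsCoatom M → ∀ y z : Z, (∀ m ∈ M, m • y = 0) →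
      (∀ m ∈ M, m • z = 0) → y ≠ 0 → ∃ s : S, z = s • y)
    {I' I : Submodule R P} (h : I' ≤ I) :
    Module.length S (pairingAnn β (I' : Set P)) + Module.length R I' ≤
      Module.length S (pairingAnn β (I : Set P)) + Module.length R I := by
  induction I using WellFoundedLT.induction with
  | _ I ih =>
    rcases h.eq_or_lt with rfl | hlt
    · exact le_rfl
    obtain ⟨K, hIK, hK⟩ := exists_le_covBy_of_lt hlt
    refine (ih K hK.lt hIK).trans ?_
    obtain ⟨b, hb, hb', hsup⟩ := hK.exists_sup_span_singleton_eq
    have hM := Submodule.isCoatom_comap_of_covBy hK hb hb'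
    -- Pairing with `b` has as kernel the annihilator of `I`, and its image is killed by a maximal
    -- left ideal, hence has length at most one. So the annihilator loses at most one where the
    -- submodule gains at least one.
    set f : pairingAnn β (K : Set P) →ₗ[S] Z := β b ∘ₗ Submodule.subtype _ with hf
    have hmem : ∀ q : pairingAnn β (K : Set P),
        ∀ m ∈ K.comap (LinearMap.toSpanSingleton R P b), m • f q = 0 := fun q m hm => by
      rw [hf, LinearMap.comp_apply, ← hβ]
      exact q.2 _ hm
    have hrange : Module.length S (LinearMap.range f) ≤ 1 := by
      refine Module.length_le_one_of_forall_exists_smul ?_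
      rintro ⟨_, y, rfl⟩ ⟨_, z, rfl⟩ hy
      obtain ⟨s, hs⟩ := hZ _ hM (f y) (f z) (hmem y) (hmem z) fun h => hy (Subtype.ext h)
      exact ⟨s, Subtype.ext hs⟩
    have hker : Module.length S (LinearMap.ker f) ≤
        Module.length S (pairingAnn β (I : Set P)) := by
      let g : LinearMap.ker f →ₗ[S] pairingAnn β (I : Set P) :=
        LinearMap.codRestrict _ (Submodule.subtype _ ∘ₗ Submodule.subtype _) (by
          rintro ⟨q, hq⟩ p (hp : p ∈ I)
          rw [← hsup] at hp
          obtain ⟨i, hi, s, hs, rfl⟩ := Submodule.mem_sup.1 hp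
          obtain ⟨c, rfl⟩ := Submodule.mem_span_singleton.1 hs
          have h1 : β i q = 0 := q.2 i hi
          have h2 : β b q = 0 := hq
          change β (i + c • b) q = 0
          rw [map_add, LinearMap.add_apply, h1, hβ, h2, smul_zero, add_zero])
      exact Module.length_le_of_injective g fun x y hxy =>
        Subtype.ext (Subtype.ext (congrArg (Subtype.val : pairingAnn β (I : Set P) → Q) hxy))
    have hlen : Module.length R K + 1 ≤ Module.length R I := by
      rw [Module.length_submodule, Module.length_submodule]
      exact Order.add_one_le_of_lt (Submodule.height_strictMono hK.lt)
    have hann : Module.length S (pairingAnn β (K : Set P)) ≤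
        Module.length S (pairingAnn β (I : Set P)) + 1 := by
      refine (Module.length_le_of_ker_le f.rangeRestrict).trans (add_le_add ?_ hrange)
      rwa [LinearMap.ker_rangeRestrict]
    calc _ ≤ Module.length S (pairingAnn β (I : Set P)) + 1 + Module.length R K := by gcongr
      _ = Module.length S (pairingAnn β (I : Set P)) + (Module.length R K + 1) := by
        rw [add_assoc, add_comm 1]
      _ ≤ _ := by gcongr

end Length

/-! ### From one side to both sides, and self-injectivity. -/

section Duality

variable {A : Type u} [Ring A]

theorem IsLeftDRing.isRightDRing (k : Type*) [Field k] [Algebra k A] [FiniteDimensional k A]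
    (hD : IsLeftDRing A) : IsRightDRing A := by
  have : IsArtinian A A := isArtinian_of_tower k inferInstance
  have : IsArtinian Aᵐᵒᵖ A := isArtinian_of_tower k inferInstance
  have : IsNoetherian A A := isNoetherian_of_tower k inferInstance
  have : IsNoetherian Aᵐᵒᵖ A := isNoetherian_of_tower k inferInstance
  obtain ⟨hM, hK⟩ := hD.exists_eq_mul_of_mem_ann k
  let β : A →+ A →ₗ[Aᵐᵒᵖ] A :=
    { toFun := fun b =>
        { toFun := fun y => b * y
          map_add' := mul_add b
          map_smul' := fun c y => (mul_assoc b y c.unop).symm }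
      map_zero' := LinearMap.ext zero_mul
      map_add' := fun a b => LinearMap.ext (add_mul a b) }
  let γ : A →+ A →ₗ[A] A :=
    { toFun := fun b =>
        { toFun := fun y => y * b
          map_add' := fun x y => add_mul x y b
          map_smul' := fun c y => mul_assoc c y b }
      map_zero' := LinearMap.ext mul_zero
      map_add' := fun a b => LinearMap.ext fun y => mul_add y a b }
  have hβ : ∀ {I' I : Ideal A}, I' ≤ I →
      Module.length Aᵐᵒᵖ (rightAnn (I' : Set A)) + Module.length A I' ≤
        Module.length Aᵐᵒᵖ (rightAnn (I : Set A)) + Module.length A I := fun h =>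
    length_pairingAnn_add_length_mono β (fun r p q => mul_assoc r p q)
      (fun M hM' y z hy hz hy0 => by
        obtain ⟨a, ha⟩ := hM M hM' y hy z hz hy0
        exact ⟨MulOpposite.op a, ha⟩) h
  have hγ : ∀ {I' I : Submodule Aᵐᵒᵖ A}, I' ≤ I →
      Module.length A (leftAnn (I' : Set A)) + Module.length Aᵐᵒᵖ I' ≤
        Module.length A (leftAnn (I : Set A)) + Module.length Aᵐᵒᵖ I := fun h =>
    length_pairingAnn_add_length_mono γ (fun r p q => (mul_assoc q p r.unop).symm)
      (fun K hK' y z hy hz hy0 => by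
        let φ : A ≃ₗ[Aᵐᵒᵖ] Aᵐᵒᵖ := MulOpposite.opLinearEquiv Aᵐᵒᵖ
        exact hK (K.comap φ.toLinearMap)
          ((Submodule.orderIsoMapComap φ).symm.isCoatom_iff K |>.2 hK')
          y (fun m hm => hy _ hm) z (fun m hm => hz _ hm) hy0) h
  have hbotr : rightAnn ((⊥ : Ideal A) : Set A) = ⊤ := eq_top_iff.2 fun a _ x hx => by
    rw [show x = 0 from hx, zero_mul]
  have hbotl : leftAnn ((⊥ : Submodule Aᵐᵒᵖ A) : Set A) = ⊤ := eq_top_iff.2 fun a _ x hx => by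
    rw [show x = 0 from hx, mul_zero]
  have htopr : rightAnn ((⊤ : Ideal A) : Set A) = ⊥ := eq_bot_iff.2 fun a ha => by
    simpa using ha 1 trivial
  have htopl : leftAnn ((⊤ : Submodule Aᵐᵒᵖ A) : Set A) = ⊥ := eq_bot_iff.2 fun a ha => by
    simpa using ha 1 trivial
  -- The case of `⊥ ≤ ⊤` in `hβ`.
  have hle : Module.length Aᵐᵒᵖ A ≤ Module.length A A := by
    have := hβ (bot_le (a := (⊤ : Ideal A)))
    rwa [hbotr, htopr, Module.length_top, Module.length_top, Module.length_bot, Module.length_bot,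
      add_zero, zero_add] at this
  -- By `hγ` this sum increases from the left length of `A` at `⊥` to the right length at `⊤`, which
  -- is no larger by `hle`; so it is constant. Right ideals with the same left annihilator therefore
  -- have the same length.
  have hconst : ∀ K : Submodule Aᵐᵒᵖ A,
      Module.length A (leftAnn (K : Set A)) + Module.length Aᵐᵒᵖ K = Module.length A A := by
    intro K
    apply le_antisymm
    · refine (hγ (le_top (a := K))).trans ?_
      rwa [htopl, Module.length_top, Module.length_bot, zero_add]
    · have := hγ (bot_le (a := K))
      rwa [hbotl, Module.length_top, Module.length_bot, add_zero] at this
  rw [isRightDRing_iff]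
  intro K
  set K' := rightAnn (leftAnn (K : Set A) : Set A) with hK'
  have hKK' : K ≤ K' := fun x hx a ha => ha x hx
  have hann : leftAnn (K' : Set A) = leftAnn (K : Set A) :=
    le_antisymm (leftAnn_anti hKK') fun a ha x hx => hx a ha
  by_contra hne
  have hlt := Submodule.height_strictMono (lt_of_le_not_ge hKK' hne)
  rw [← Module.length_submodule, ← Module.length_submodule] at hlt
  have h1 := (hconst K).trans (hconst K').symm
  rw [hann] at h1
  have hfin : Module.length A (leftAnn (K : Set A)) ≠ ⊤ := Module.length_ne_top
  exact hlt.ne ((ENat.add_right_injective_of_ne_top hfin).eq_iff.1 h1)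

theorem IsRightDRing.isLeftDRing (k : Type*) [Field k] [Algebra k A] [FiniteDimensional k A]
    (hD : IsRightDRing A) : IsLeftDRing A := by
  have : FiniteDimensional k Aᵐᵒᵖ := Module.Finite.equiv (MulOpposite.opLinearEquiv k)
  exact isRightDRing_mulOpposite.1 ((isLeftDRing_mulOpposite.2 hD).isRightDRing k)

theorem IsRightDRing.exists_eq_mul (h : IsRightDRing A) {x y : A}
    (hxy : ∀ a, a * x = 0 → a * y = 0) : ∃ c, y = x * c := by
  have : y ∈ Submodule.span Aᵐᵒᵖ {x} :=
    isRightDRing_iff.1 h _ fun a ha => hxy a (ha x (Submodule.mem_span_singleton_self x))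
  obtain ⟨c, hc⟩ := Submodule.mem_span_singleton.1 this
  exact ⟨c.unop, hc.symm⟩

/-- In an artinian two-sided D-ring, every homomorphism from a left ideal to the ring is a right
multiplication. -/
theorem IsLeftDRing.exists_forall_eq_mul [IsArtinian A A] [IsNoetherian A A] (hL : IsLeftDRing A)
    (hR : IsRightDRing A) (I : Ideal A) (g : I →ₗ[A] A) : ∃ c : A, ∀ x : I, g x = x * c := by
  induction I using WellFoundedLT.induction with
  | _ I ih =>
    rcases eq_bot_or_bot_lt I with rfl | hpos
    · exact ⟨0, fun x => by rw [Subsingleton.elim x 0, map_zero, mul_zero]⟩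
    obtain ⟨I', -, hI'⟩ := exists_le_covBy_of_lt hpos
    have hsmul : ∀ a (x : I), g (a • x) = a * g x := fun a x => g.map_smul a x
    obtain ⟨c, hc⟩ := ih I' hI'.lt (g ∘ₗ Submodule.inclusion hI'.le)
    obtain ⟨b, hb, hb', hsup⟩ := hI'.exists_sup_span_singleton_eq
    have hM := Submodule.isCoatom_comap_of_covBy hI' hb hb'
    obtain ⟨y, hy, hby⟩ : ∃ y ∈ rightAnn (I' : Set A), b * y ≠ 0 := by
      by_contra! h
      exact hb' (isLeftDRing_iff.1 hL I' h)
    have hgb : ∀ a (h : a ∈ I'), g ⟨a, hI'.le h⟩ = a * c := fun a h => hc ⟨a, h⟩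
    -- `g` minus right multiplication by `c` vanishes on `I'`, so its value at `b` is killed by the
    -- maximal left ideal `{a | a * b ∈ I'}`, which is also the annihilator of `b * y`. Adding `y *
    -- d` to `c` corrects the value at `b` and, since `I' y = 0`, changes nothing on `I'`.
    obtain ⟨d, hd⟩ := hR.exists_eq_mul (x := b * y) (y := g ⟨b, hb⟩ - b * c) fun a ha => by
      have hle : Submodule.comap (LinearMap.toSpanSingleton A A b) I' ≤ leftAnn {b * y} := by
        rintro m hm _ rfl
        rw [← mul_assoc]
        exact hy _ hm
      have hmem : a ∈ Submodule.comap (LinearMap.toSpanSingleton A A b) I' := by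
        rcases hle.eq_or_lt with h | h
        · rw [h]
          rintro _ rfl
          exact ha
        · have h1 : (1 : A) ∈ leftAnn {b * y} := hM.2 _ h ▸ Submodule.mem_top
          exact absurd (by simpa using h1 _ rfl) hby
      have h1 : g (a • ⟨b, hb⟩) = a * b * c := hgb (a * b) hmem
      rw [mul_sub, ← hsmul, h1, mul_assoc, sub_self]
    refine ⟨c + y * d, fun ⟨x, hx⟩ => ?_⟩
    obtain ⟨i, hi, s, hs, his⟩ := Submodule.mem_sup.1 (hsup.symm ▸ hx)
    obtain ⟨t, rfl⟩ := Submodule.mem_span_singleton.1 hs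
    subst his
    have h1 : g ⟨i + t • b, hx⟩ = g ⟨i, hI'.le hi⟩ + t * g ⟨b, hb⟩ := by
      rw [← hsmul, ← map_add]
      rfl
    have h2 : i * y = 0 := hy i hi
    have h3 : g ⟨b, hb⟩ = b * c + b * y * d := by rw [← hd, add_sub_cancel]
    rw [h1, hgb i hi, h3]
    simp only [smul_eq_mul]
    simp only [mul_add, add_mul, ← mul_assoc, h2, zero_mul]
    abel

theorem IsLeftDRing.injective_self [IsArtinian A A] [IsNoetherian A A] (hL : IsLeftDRing A)
    (hR : IsRightDRing A) : Module.Injective A A := by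
  refine Module.Baer.injective fun I g => ?_
  obtain ⟨c, hc⟩ := hL.exists_forall_eq_mul hR I g
  exact ⟨LinearMap.toSpanSingleton A A c, fun x hx => (hc ⟨x, hx⟩).symm⟩

end Duality

theorem IsLeftDRing.isQFRing {A : Type u} [Ring A] (k : Type*) [Field k] [Algebra k A]
    [FiniteDimensional k A] (hL : IsLeftDRing A) : IsQFRing A := by
  have hR := hL.isRightDRing k
  have : FiniteDimensional k Aᵐᵒᵖ := Module.Finite.equiv (MulOpposite.opLinearEquiv k)
  have : IsArtinian A A := isArtinian_of_tower k inferInstance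
  have : IsNoetherian A A := isNoetherian_of_tower k inferInstance
  have : IsArtinian Aᵐᵒᵖ Aᵐᵒᵖ := isArtinian_of_tower k inferInstance
  have : IsNoetherian Aᵐᵒᵖ Aᵐᵒᵖ := isNoetherian_of_tower k inferInstance
  have hinj := (isLeftDRing_mulOpposite.2 hR).injective_self (isRightDRing_mulOpposite.2 hL)
  exact ⟨inferInstance, isArtinian_of_tower k inferInstance, hL.injective_self hR,
    ((Module.Baer.of_injective hinj).of_equiv
      (MulOpposite.opLinearEquiv Aᵐᵒᵖ : A ≃ₗ[Aᵐᵒᵖ] Aᵐᵒᵖ).symm).injective⟩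

theorem corollary3p5 (k : Type*) [Field k] (A : Type u) [Ring A] [Algebra k A]
    (hA : IsProfiniteAlgebra.{w, v} k A) (hD : IsLeftDRing A ∨ IsRightDRing A) :
    IsQFRing A ∧ FiniteDimensional k A := by
  have := hA.finiteDimensional hD
  exact ⟨(hD.elim id fun h => h.isLeftDRing k).isQFRing k, this⟩
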